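/- Let $\mathcal Y$ be a finite set and $\emptyset\neq\mathcal X\subseteq\mathcal Y$. A channel $W$ from $\mathcal X$ to $\mathcal Y$ (transition probabilities $W(y|x)\ge 0$ with $\sum_{y\in\mathcal Y} W(y|x)=1$ for every $x\in\mathcal X$) is an $\varepsilon$-noise channel, where $0\le\varepsilon<1$, if $W(x|x)\ge 1-\varepsilon$ for all $x\in\mathcal X$. Write $W^n(\mathbf y|\mathbf x)=\prod_{j=1}^n W(y^{(j)}|x^{(j)})$ and $\operatorname{supp}(W)=\{(x,y): W(y|x)>0\}$. A Sperner code of blocklength $n$ for $W$ is a family $\mathbf x_1,\dots,\mathbf x_M\in\mathcal X^n$ with $W^n(\mathbf x_m|\mathbf x_{m'})=0$ whenever $m\ne m'$. The Sperner capacity $C_{\mathrm{sp}}(W)$, which depends on $W$ only through $\operatorname{supp}(W)$, is the supremum of $\frac1n\log M$ over all $n\ge1$ and all Sperner codes of blocklength $n$. For a code $\mathbf x_1,\dots,\mathbf x_M\in\mathcal X^n$, the zero-undetected-error decoder declares an erasure at the output $\mathbf y\in\mathcal Y^n$ if $W^n(\mathbf y|\mathbf x_m)>0$ for two or more $m$.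 The zero-undetected-error capacity $C_{\mathrm{eo}}(W)$ is the supremum of all $R$ for which there are codes of blocklengths $n=1,2,\dots$, with at least $e^{nR}$ messages for all large $n$, whose probability of erasure under this decoder tends to zero as $n\to\infty$; the probability of erasure is either the maximum or the average over the messages (the theorem holds for both criteria). Theorem. For $\varepsilon$-noise channels, $\lim_{\varepsilon\to0}C_{\mathrm{eo}}=C_{\mathrm{sp}}$, uniformly over all $\varepsilon$-noise channels with a given support: for every $S\subseteq\mathcal X\times\mathcal Y$ and every $\delta>0$ there is an $\varepsilon_0\in(0,1)$ such that for every $\varepsilon\in[0,\varepsilon_0)$ and every $\varepsilon$-noise channel $W$ with $\operatorname{supp}(W)=S$, $$|C_{\mathrm{eo}}(W)-C_{\mathrm{sp}}(W)|<\delta.$$ -/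

import Mathlib

open Filter Topology

noncomputable section

/-- A discrete memoryless channel with finite input alphabet `A` and finite output alphabet `B`:
`W.law x y` is the transition probability `W(y | x)`. -/
structure DMC (A B : Type*) [Fintype B] where
  law : A → B → ℝ
  law_nonneg : ∀ x y, 0 ≤ law x y
  law_sum : ∀ x, ∑ y, law x y = 1

namespace DMC

variable {A B : Type*} [Fintype B]

/-- The support of `W`: all pairs `(x, y)` with `W(y | x) > 0`. -/
def supp (W : DMC A B) : Set (A × B) := {p | 0 < W.law p.1 p.2}

/-- The `n`-letter transition probability `Wⁿ(y | x)`, for words `x` and `y` of length `n`. -/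
def lawN (W : DMC A B) {n : ℕ} (x : Fin n → A) (y : Fin n → B) : ℝ :=
  ∏ j, W.law (x j) (y j)

open Classical in
/-- The number of messages that cannot be ruled out when `y` is received and the codewords of
the messages `m : Fin M` are `c m`. -/
def numPossible (W : DMC A B) {n M : ℕ} (c : Fin M → Fin n → A) (y : Fin n → B) : ℕ :=
  (Finset.univ.filter fun m : Fin M => 0 < W.lawN (c m) y).card

open Classical in
/-- The probability of erasure, given that message `m` is sent, of the zero-undetected-error
decoder: it erases exactly when two or more messages could have produced the output. -/
def erasureProb (W : DMC A B) {n M : ℕ} (c : Fin M → Fin n → A) (m : Fin M) : ℝ :=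
  ∑ y ∈ Finset.univ.filter (fun y : Fin n → B => 1 < W.numPossible c y), W.lawN (c m) y

/-- The maximal (over the messages) probability of erasure. -/
def maxErasureProb (W : DMC A B) {n M : ℕ} (c : Fin M → Fin n → A) : ℝ :=
  ⨆ m, W.erasureProb c m

/-- The average (over the messages) probability of erasure. -/
def avgErasureProb (W : DMC A B) {n M : ℕ} (c : Fin M → Fin n → A) : ℝ :=
  (∑ m, W.erasureProb c m) / M

/-- The rate `R` is achievable with zero-undetected-error decoders under the maximal erasure
probability criterion: there are codes, one for each blocklength `n`, with at least `exp (n R)`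
messages for all large `n`, whose maximal probability of erasure tends to zero. -/
def ZueAchievable (W : DMC A B) (R : ℝ) : Prop :=
  ∃ (M : ℕ → ℕ) (c : ∀ n, Fin (M n) → Fin n → A),
    (∀ᶠ n : ℕ in atTop, Real.exp (n * R) ≤ M n) ∧
    Tendsto (fun n => W.maxErasureProb (c n)) atTop (𝓝 0)

/-- The same under the average erasure probability criterion. -/
def ZueAchievableAvg (W : DMC A B) (R : ℝ) : Prop :=
  ∃ (M : ℕ → ℕ) (c : ∀ n, Fin (M n) → Fin n → A),
    (∀ᶠ n : ℕ in atTop, Real.exp (n * R) ≤ M n) ∧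
    Tendsto (fun n => W.avgErasureProb (c n)) atTop (𝓝 0)

/-- The zero-undetected-error capacity, in nats (maximal erasure probability criterion). -/
def zueCapacity (W : DMC A B) : ℝ := sSup {R : ℝ | W.ZueAchievable R}

/-- The zero-undetected-error capacity, in nats (average erasure probability criterion). -/
def zueCapacityAvg (W : DMC A B) : ℝ := sSup {R : ℝ | W.ZueAchievableAvg R}

end DMC

namespace DMC

variable {Y : Type*} [Fintype Y] {X : Finset Y}

/-- `W`, whose input alphabet `X` is a subset of its output alphabet `Y`, is an `ε`-noise
channel. -/
def IsNoise (W : DMC X Y) (ε : ℝ) : Prop :=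
  ∀ x : X, 1 - ε ≤ W.law x (x : Y)

/-- The codewords `c m` form a Sperner code: the channel never turns a codeword into another
codeword. -/
def IsSpernerCode (W : DMC X Y) {n M : ℕ} (c : Fin M → Fin n → X) : Prop :=
  ∀ m m' : Fin M, m ≠ m' → W.lawN (c m') (fun j => (c m j : Y)) = 0

/-- The Sperner capacity, in nats: the supremum of the rates `log M / n` of Sperner codes, over
all blocklengths `n ≥ 1`. -/
def spernerCapacity (W : DMC X Y) : ℝ :=
  sSup {R : ℝ | ∃ (n M : ℕ) (c : Fin M → Fin n → X),
    1 ≤ n ∧ 1 ≤ M ∧ W.IsSpernerCode c ∧ R = Real.log M / n}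

end DMC

end

/-! Low noise changes only a small fraction of the letters, except with exponentially small
probability (`exists_sum_lawN_far_le`), and words close to a given one are exponentially few
(`exists_card_hammingBall_le`). Both rates depend on the noise level and the radius only, which
gives uniformity.

Upper bound (`card_le_of_avgErasureProb_le`): each good message has an output near its codeword that
rules out every other message. Sort these messages by where that output differs from the codeword
and by the codeword letters there. There are few classes, and the codewords of one class form a
Sperner code.

Lower bound (`exists_zueAchievable_of_isSpernerCode`): use a Sperner code with rate near capacity as
inner code and a Gilbert–Varshamov outer code. A few changes leave intact some block where two given
outer words differ, and that block rules out the wrong word. The outer rate loss is small because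
the required relative distance is small. -/

/-! ### Volume of Hamming balls and separated sets. -/

section HammingBalls

/-- The exponential moment of Hamming distance factors over letters. Negative `t` serves to count
balls, positive `t` to bound the noise tail. -/
theorem sum_prod_mul_exp_hammingDist {B : Type*} [Fintype B] [DecidableEq B] {n : ℕ}
    (g : Fin n → B → ℝ) (x : Fin n → B) (t : ℝ) :
    ∑ y : Fin n → B, (∏ j, g j (y j)) * Real.exp (t * hammingDist x y) =
      ∏ j, ∑ b, g j b * Real.exp (if x j = b then 0 else t) := by
  rw [Finset.prod_univ_sum, Fintype.piFinset_univ]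
  refine Finset.sum_congr rfl fun y _ => ?_
  rw [Finset.prod_mul_distrib, ← Real.exp_sum]
  congr 2
  simp only [hammingDist, Finset.card_filter]
  push_cast
  rw [Finset.mul_sum]
  refine Finset.sum_congr rfl fun j _ => ?_
  by_cases h : x j = y j <;> simp [h]

/-- Hamming balls of small relative radius have small exponential growth rate. -/
theorem exists_card_hammingBall_le (A : Type*) [Fintype A] [DecidableEq A] {η : ℝ} (hη : 0 < η) :
    ∃ α : ℝ, 0 < α ∧ ∀ (n : ℕ) (x : Fin n → A),
      ((Finset.univ.filter fun y : Fin n → A => (hammingDist x y : ℝ) ≤ α * n).card : ℝ) ≤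
        Real.exp (η * n) := by
  -- Half of `η` bounds the moment per letter; the other half is the Chernoff cost `t * α` with `α =
  -- η / (2 * t)`.
  obtain ⟨t, ht, hs⟩ : ∃ t : ℝ, 0 < t ∧ Fintype.card A * Real.exp (-t) ≤ η / 2 := by
    have h : Tendsto (fun t : ℝ => Fintype.card A * Real.exp (-t)) atTop (𝓝 0) := by
      simpa using Real.tendsto_exp_neg_atTop_nhds_zero.const_mul (Fintype.card A : ℝ)
    exact ((eventually_gt_atTop 0).and (h.eventually_le_const (half_pos hη))).exists
  refine ⟨η / (2 * t), by positivity, fun n x => ?_⟩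
  have hfac : ∀ j, ∑ b, (1 : ℝ) * Real.exp (if x j = b then 0 else -t) ≤ Real.exp (η / 2) := by
    intro j
    calc ∑ b, (1 : ℝ) * Real.exp (if x j = b then 0 else -t)
        ≤ ∑ b, ((if x j = b then 1 else 0) + Real.exp (-t)) := by
          refine Finset.sum_le_sum fun b _ => ?_
          by_cases h : x j = b <;> simp [h, Real.exp_nonneg]
      _ = 1 + Fintype.card A * Real.exp (-t) := by
          simp [Finset.sum_add_distrib]
      _ ≤ η / 2 + 1 := by linarith
      _ ≤ Real.exp (η / 2) := Real.add_one_le_exp _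
  have hgen := sum_prod_mul_exp_hammingDist (fun _ _ => (1 : ℝ)) x (-t)
  have hball : ((Finset.univ.filter fun y : Fin n → A =>
      (hammingDist x y : ℝ) ≤ η / (2 * t) * n).card : ℝ) * Real.exp (-(η / 2 * n)) ≤
      Real.exp (η / 2 * n) := by
    calc _ = ∑ y ∈ Finset.univ.filter (fun y : Fin n → A =>
            (hammingDist x y : ℝ) ≤ η / (2 * t) * n), Real.exp (-(η / 2 * n)) := by
          rw [Finset.sum_const, nsmul_eq_mul]
      _ ≤ ∑ y ∈ Finset.univ.filter (fun y : Fin n → A =>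
            (hammingDist x y : ℝ) ≤ η / (2 * t) * n),
            (∏ _j : Fin n, (1 : ℝ)) * Real.exp (-t * hammingDist x y) := by
          refine Finset.sum_le_sum fun y hy => ?_
          rw [Finset.prod_const_one, one_mul, Real.exp_le_exp]
          have := mul_le_mul_of_nonneg_left (Finset.mem_filter.1 hy).2 ht.le
          have e : t * (η / (2 * t) * n) = η / 2 * n := by field_simp
          linarith
      _ ≤ ∑ y, (∏ _j : Fin n, (1 : ℝ)) * Real.exp (-t * hammingDist x y) :=
          Finset.sum_le_sum_of_subset_of_nonneg (Finset.subset_univ _)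
            fun y _ _ => by positivity
      _ = _ := hgen
      _ ≤ ∏ _j : Fin n, Real.exp (η / 2) :=
          Finset.prod_le_prod (fun j _ => by positivity) fun j _ => hfac j
      _ = Real.exp (η / 2 * n) := by
          rw [Finset.prod_const, Finset.card_univ, Fintype.card_fin, ← Real.exp_nat_mul, mul_comm]
  rw [Real.exp_neg, ← div_eq_mul_inv, div_le_iff₀ (Real.exp_pos _), ← Real.exp_add] at hball
  rwa [← add_mul, add_halves] at hball

/-- The Gilbert–Varshamov bound. -/
theorem exists_separated_finset {A : Type*} [Fintype A] [DecidableEq A] {n : ℕ} (r V : ℝ)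
    (hr : 0 ≤ r)
    (hV : ∀ x : Fin n → A,
      ((Finset.univ.filter fun y : Fin n → A => (hammingDist x y : ℝ) ≤ r).card : ℝ) ≤ V) :
    ∃ C : Finset (Fin n → A), (∀ x ∈ C, ∀ y ∈ C, x ≠ y → r < hammingDist x y) ∧
      (Fintype.card A : ℝ) ^ n ≤ C.card * V := by
  -- Balls around a largest separated set cover everything: an uncovered word could be added.
  obtain ⟨C, hC, hmax⟩ := Finset.exists_max_image
    (Finset.univ.filter fun C : Finset (Fin n → A) =>
      ∀ x ∈ C, ∀ y ∈ C, x ≠ y → r < hammingDist x y) Finset.card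
    ⟨∅, by simp⟩
  simp only [Finset.mem_filter, Finset.mem_univ, true_and] at hC hmax
  refine ⟨C, hC, ?_⟩
  have hcover : (Finset.univ : Finset (Fin n → A)) ⊆
      C.biUnion fun x => Finset.univ.filter fun y => (hammingDist x y : ℝ) ≤ r := by
    intro z _
    by_contra hz
    simp only [Finset.mem_biUnion, Finset.mem_filter, Finset.mem_univ, true_and, not_exists,
      not_and, not_le] at hz
    have hzC : z ∉ C := fun h => by
      have := hz z h
      rw [hammingDist_self, Nat.cast_zero] at this
      linarith
    have h := hmax (insert z C) (by
      intro x hx y hy hxy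
      rcases Finset.mem_insert.1 hx with rfl | hx <;> rcases Finset.mem_insert.1 hy with rfl | hy
      · exact absurd rfl hxy
      · rw [hammingDist_comm]; exact hz y hy
      · exact hz x (by assumption)
      · exact hC x hx y hy hxy)
    rw [Finset.card_insert_of_notMem hzC] at h
    omega
  calc (Fintype.card A : ℝ) ^ n = ((Finset.univ : Finset (Fin n → A)).card : ℝ) := by
        simp
    _ ≤ ∑ x ∈ C, ((Finset.univ.filter fun y : Fin n → A =>
          (hammingDist x y : ℝ) ≤ r).card : ℝ) := by
        exact_mod_cast (Finset.card_le_card hcover).trans Finset.card_biUnion_le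
    _ ≤ ∑ x ∈ C, V := Finset.sum_le_sum fun x _ => hV x
    _ = C.card * V := by rw [Finset.sum_const, nsmul_eq_mul]

end HammingBalls

namespace DMC

/-! ### Erasure probabilities of general channels. -/

section General

variable {A B : Type*} [Fintype B]

theorem lawN_nonneg (W : DMC A B) {n : ℕ} (x : Fin n → A) (y : Fin n → B) : 0 ≤ W.lawN x y :=
  Finset.prod_nonneg fun _ _ => W.law_nonneg _ _

theorem sum_lawN (W : DMC A B) {n : ℕ} (x : Fin n → A) : ∑ y, W.lawN x y = 1 := by
  classical
  simp only [lawN]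
  rw [← Fintype.piFinset_univ, ← Finset.prod_univ_sum]
  simp [W.law_sum]

theorem lawN_pos_iff (W : DMC A B) {n : ℕ} (x : Fin n → A) (y : Fin n → B) :
    0 < W.lawN x y ↔ ∀ j, 0 < W.law (x j) (y j) := by
  refine ⟨fun h j => ?_, fun h => Finset.prod_pos fun j _ => h j⟩
  refine lt_of_le_of_ne (W.law_nonneg _ _) fun h0 => h.ne' ?_
  exact Finset.prod_eq_zero (Finset.mem_univ j) h0.symm

theorem lawN_eq_zero_iff (W : DMC A B) {n : ℕ} (x : Fin n → A) (y : Fin n → B) :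
    W.lawN x y = 0 ↔ ∃ j, W.law (x j) (y j) = 0 := by
  simp [lawN, Finset.prod_eq_zero_iff]

theorem erasureProb_nonneg (W : DMC A B) {n M : ℕ} (c : Fin M → Fin n → A) (m : Fin M) :
    0 ≤ W.erasureProb c m :=
  Finset.sum_nonneg fun _ _ => W.lawN_nonneg _ _

theorem erasureProb_le_maxErasureProb (W : DMC A B) {n M : ℕ} (c : Fin M → Fin n → A)
    (m : Fin M) : W.erasureProb c m ≤ W.maxErasureProb c :=
  le_ciSup (f := W.erasureProb c) (Set.finite_range _).bddAbove m

theorem maxErasureProb_nonneg (W : DMC A B) {n M : ℕ} (c : Fin M → Fin n → A) :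
    0 ≤ W.maxErasureProb c :=
  Real.iSup_nonneg fun m => W.erasureProb_nonneg c m

theorem avgErasureProb_nonneg (W : DMC A B) {n M : ℕ} (c : Fin M → Fin n → A) :
    0 ≤ W.avgErasureProb c :=
  div_nonneg (Finset.sum_nonneg fun m _ => W.erasureProb_nonneg c m) M.cast_nonneg

theorem avgErasureProb_le_maxErasureProb (W : DMC A B) {n M : ℕ} (c : Fin M → Fin n → A) :
    W.avgErasureProb c ≤ W.maxErasureProb c := by
  refine div_le_of_le_mul₀ M.cast_nonneg (W.maxErasureProb_nonneg c) ?_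
  calc ∑ m, W.erasureProb c m ≤ ∑ _m : Fin M, W.maxErasureProb c :=
        Finset.sum_le_sum fun m _ => W.erasureProb_le_maxErasureProb c m
    _ = W.maxErasureProb c * M := by simp [mul_comm]

theorem ZueAchievable.zueAchievableAvg {W : DMC A B} {R : ℝ} (h : W.ZueAchievable R) :
    W.ZueAchievableAvg R := by
  obtain ⟨M, c, hM, hc⟩ := h
  exact ⟨M, c, hM, squeeze_zero (fun n => W.avgErasureProb_nonneg _)
    (fun n => W.avgErasureProb_le_maxErasureProb _) hc⟩

/-- At least half of the messages have at most twice the average erasure probability. -/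
theorem half_le_card_erasureProb_le (W : DMC A B) {n M : ℕ} (c : Fin M → Fin n → A) {p : ℝ}
    (hp : 0 < p) (h : W.avgErasureProb c ≤ p) :
    (M : ℝ) / 2 ≤ (Finset.univ.filter fun m => W.erasureProb c m ≤ 2 * p).card := by
  rcases Nat.eq_zero_or_pos M with rfl | hM
  · simp
  have hM' : (0 : ℝ) < M := by exact_mod_cast hM
  have hsum : ∑ m, W.erasureProb c m ≤ p * M := (div_le_iff₀ hM').1 h
  have hbad : ((Finset.univ.filter fun m => ¬ W.erasureProb c m ≤ 2 * p).card : ℝ) * (2 * p) ≤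
      p * M := by
    refine le_trans ?_ hsum
    calc _ = ∑ m ∈ Finset.univ.filter (fun m => ¬ W.erasureProb c m ≤ 2 * p), 2 * p := by
          rw [Finset.sum_const, nsmul_eq_mul]
      _ ≤ ∑ m ∈ Finset.univ.filter (fun m => ¬ W.erasureProb c m ≤ 2 * p),
            W.erasureProb c m :=
          Finset.sum_le_sum fun m hm => (not_le.1 (Finset.mem_filter.1 hm).2).le
      _ ≤ _ := Finset.sum_le_sum_of_subset_of_nonneg (Finset.subset_univ _)
          fun m _ _ => W.erasureProb_nonneg c m
  have hcard : ((Finset.univ.filter fun m => W.erasureProb c m ≤ 2 * p).card : ℝ) +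
      (Finset.univ.filter fun m => ¬ W.erasureProb c m ≤ 2 * p).card = M := by
    have := Finset.card_filter_add_card_filter_not (s := (Finset.univ : Finset (Fin M)))
      (fun m => W.erasureProb c m ≤ 2 * p)
    rw [Finset.card_univ, Fintype.card_fin] at this
    exact_mod_cast this
  have : ((Finset.univ.filter fun m => ¬ W.erasureProb c m ≤ 2 * p).card : ℝ) * 2 ≤ M :=
    le_of_mul_le_mul_right (by linarith) hp
  linarith

end General

/-! ### Sperner codes and dependence on the support. -/

section Noise

variable {Y : Type*} [Fintype Y] {X : Finset Y}

theorem IsNoise.law_self_pos {W : DMC X Y} {ε : ℝ} (hW : W.IsNoise ε) (hε : ε < 1) (x : X) :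
    0 < W.law x x := by
  have := hW x
  linarith

theorem law_eq_zero_iff_of_supp_eq {W W' : DMC X Y} (h : W.supp = W'.supp) (x : X) (y : Y) :
    W.law x y = 0 ↔ W'.law x y = 0 := by
  have h1 : 0 < W.law x y ↔ 0 < W'.law x y := Set.ext_iff.1 h (x, y)
  have h2 := W.law_nonneg x y
  have h3 := W'.law_nonneg x y
  constructor <;> intro h0 <;> by_contra h4
  · exact (h1.2 (lt_of_le_of_ne h3 (Ne.symm h4))).ne' h0
  · exact (h1.1 (lt_of_le_of_ne h2 (Ne.symm h4))).ne' h0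

theorem isSpernerCode_iff_of_supp_eq {W W' : DMC X Y} (h : W.supp = W'.supp) {n M : ℕ}
    (c : Fin M → Fin n → X) : W.IsSpernerCode c ↔ W'.IsSpernerCode c := by
  simp only [IsSpernerCode, lawN_eq_zero_iff, law_eq_zero_iff_of_supp_eq h]

theorem spernerCapacity_eq_of_supp_eq {W W' : DMC X Y} (h : W.supp = W'.supp) :
    W.spernerCapacity = W'.spernerCapacity := by
  simp only [spernerCapacity, isSpernerCode_iff_of_supp_eq h]

theorem IsSpernerCode.injective {W : DMC X Y} (hd : ∀ x : X, 0 < W.law x x) {n M : ℕ}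
    {c : Fin M → Fin n → X} (hc : W.IsSpernerCode c) : Function.Injective c := by
  intro m m' h
  by_contra hne
  have h0 := hc m m' hne
  rw [h] at h0
  exact ((W.lawN_pos_iff _ _).2 fun j => hd (c m' j)).ne' h0

/-- Every word can reach itself, so the words of a Sperner code are distinct and number at most `|X|
^ n`. -/
theorem bddAbove_spernerRates {W : DMC X Y} (hd : ∀ x : X, 0 < W.law x x) :
    BddAbove {R : ℝ | ∃ (n M : ℕ) (c : Fin M → Fin n → X),
      1 ≤ n ∧ 1 ≤ M ∧ W.IsSpernerCode c ∧ R = Real.log M / n} := by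
  refine ⟨Real.log (Fintype.card X), ?_⟩
  rintro R ⟨n, M, c, hn, hM, hc, rfl⟩
  have hcard : M ≤ Fintype.card X ^ n := by
    simpa using Fintype.card_le_of_injective c (hc.injective hd)
  have hn' : (0 : ℝ) < n := by exact_mod_cast hn
  rw [div_le_iff₀ hn', mul_comm, ← Real.log_pow]
  exact Real.log_le_log (by exact_mod_cast hM) (by exact_mod_cast hcard)

theorem nonempty_spernerRates (W : DMC X Y) (hX : X.Nonempty) :
    {R : ℝ | ∃ (n M : ℕ) (c : Fin M → Fin n → X),
      1 ≤ n ∧ 1 ≤ M ∧ W.IsSpernerCode c ∧ R = Real.log M / n}.Nonempty :=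
  ⟨_, 1, 1, fun _ _ => ⟨hX.choose, hX.choose_spec⟩, le_rfl, le_rfl,
    fun m m' h => absurd (Subsingleton.elim m m') h, rfl⟩

theorem IsSpernerCode.card_le {W : DMC X Y} (hd : ∀ x : X, 0 < W.law x x) {n M : ℕ} (hn : 1 ≤ n)
    {c : Fin M → Fin n → X} (hc : W.IsSpernerCode c) :
    (M : ℝ) ≤ Real.exp (n * W.spernerCapacity) := by
  rcases Nat.eq_zero_or_pos M with rfl | hM
  · simpa using Real.exp_nonneg _
  have h : Real.log M / n ≤ W.spernerCapacity :=
    le_csSup (bddAbove_spernerRates hd) ⟨n, M, c, hn, hM, hc, rfl⟩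
  have hn' : (0 : ℝ) < n := by exact_mod_cast hn
  have hM' : (0 : ℝ) < M := by exact_mod_cast hM
  rw [div_le_iff₀ hn'] at h
  rw [← Real.log_le_iff_le_exp hM', mul_comm]
  exact h

theorem card_le_of_pairwise_lawN_eq_zero {W : DMC X Y} (hd : ∀ x : X, 0 < W.law x x) {n M : ℕ}
    (hn : 1 ≤ n) (c : Fin M → Fin n → X) (F : Finset (Fin M))
    (hF : ∀ m ∈ F, ∀ m' ∈ F, m ≠ m' → W.lawN (c m') (fun j => (c m j : Y)) = 0) :
    (F.card : ℝ) ≤ Real.exp (n * W.spernerCapacity) := by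
  refine IsSpernerCode.card_le hd hn (c := fun i => c (F.equivFin.symm i)) fun i i' hi => ?_
  refine hF _ (F.equivFin.symm i).2 _ (F.equivFin.symm i').2 fun h => hi ?_
  exact F.equivFin.symm.injective (Subtype.ext h)

/-! ### Noise tail and the upper bound. -/

variable [DecidableEq Y]

/-- At low noise, the channel rarely changes more than a given fraction of the letters. -/
theorem exists_sum_lawN_far_le {α : ℝ} (hα : 0 < α) :
    ∃ ε₀ : ℝ, 0 < ε₀ ∧ ε₀ < 1 ∧ ∀ ε : ℝ, ε < ε₀ → ∀ W : DMC X Y, W.IsNoise ε →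
      ∀ (n : ℕ) (x : Fin n → X),
        ∑ y ∈ Finset.univ.filter (fun y : Fin n → Y =>
          α * n < (hammingDist (fun j => (x j : Y)) y : ℝ)), W.lawN x y ≤ (1 / 2) ^ n := by
  -- With `ε₀ = exp (-t)` the moment per letter is at most 2, while beyond radius `α * n` the weight
  -- exceeds `4 ^ n`; the tail is at most `(2 / 4) ^ n`.
  set t : ℝ := Real.log 4 / α with ht
  have ht0 : 0 < t := div_pos (Real.log_pos (by norm_num)) hα
  refine ⟨Real.exp (-t), Real.exp_pos _, Real.exp_lt_one_iff.2 (by linarith), ?_⟩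
  intro ε hε W hW n x
  have hfac : ∀ j, ∑ b, W.law (x j) b * Real.exp (if (x j : Y) = b then 0 else t) ≤ 2 := by
    intro j
    calc ∑ b, W.law (x j) b * Real.exp (if (x j : Y) = b then 0 else t)
        ≤ ∑ b, ((if (x j : Y) = b then W.law (x j) b - W.law (x j) b * Real.exp t else 0) +
            W.law (x j) b * Real.exp t) := by
          refine Finset.sum_le_sum fun b _ => ?_
          by_cases h : (x j : Y) = b <;> simp [h]
      _ = W.law (x j) (x j) + (1 - W.law (x j) (x j)) * Real.exp t := by
          rw [Finset.sum_add_distrib, ← Finset.sum_mul, W.law_sum]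
          simp only [Finset.sum_ite_eq, Finset.mem_univ, if_true]
          ring
      _ ≤ 1 + Real.exp (-t) * Real.exp t := by
          have h1 : W.law (x j) (x j) ≤ 1 := by
            rw [← W.law_sum (x j)]
            exact Finset.single_le_sum (f := W.law (x j)) (fun b _ => W.law_nonneg _ _)
              (Finset.mem_univ (x j : Y))
          have h2 := hW (x j)
          gcongr
          linarith
      _ = 2 := by rw [← Real.exp_add]; norm_num
  have hgen := sum_prod_mul_exp_hammingDist (fun j => W.law (x j)) (fun j => (x j : Y)) t
  have hmain : (∑ y ∈ Finset.univ.filter (fun y : Fin n → Y =>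
      α * n < (hammingDist (fun j => (x j : Y)) y : ℝ)), W.lawN x y) * 4 ^ n ≤ 2 ^ n := by
    rw [Finset.sum_mul]
    calc _ ≤ ∑ y ∈ Finset.univ.filter (fun y : Fin n → Y =>
          α * n < (hammingDist (fun j => (x j : Y)) y : ℝ)),
          W.lawN x y * Real.exp (t * hammingDist (fun j => (x j : Y)) y) := by
          refine Finset.sum_le_sum fun y hy => ?_
          refine mul_le_mul_of_nonneg_left ?_ (W.lawN_nonneg _ _)
          have h4 : (4 : ℝ) ^ n = Real.exp (t * (α * n)) := by
            rw [← mul_assoc, ht, div_mul_cancel₀ _ hα.ne', mul_comm, Real.exp_nat_mul,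
              Real.exp_log (by norm_num)]
          rw [h4, Real.exp_le_exp]
          exact mul_le_mul_of_nonneg_left (Finset.mem_filter.1 hy).2.le ht0.le
      _ ≤ ∑ y, W.lawN x y * Real.exp (t * hammingDist (fun j => (x j : Y)) y) :=
          Finset.sum_le_sum_of_subset_of_nonneg (Finset.subset_univ _)
            fun y _ _ => mul_nonneg (W.lawN_nonneg _ _) (Real.exp_nonneg _)
      _ = _ := hgen
      _ ≤ ∏ _j : Fin n, (2 : ℝ) := Finset.prod_le_prod
          (fun j _ => Finset.sum_nonneg fun b _ => mul_nonneg (W.law_nonneg _ _)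
            (Real.exp_nonneg _)) fun j _ => hfac j
      _ = 2 ^ n := by simp
  rw [← le_div_iff₀ (by positivity), ← div_pow] at hmain
  norm_num at hmain ⊢
  exact hmain

/-- For `n ≥ 2` far outputs have mass at most 1/4 and erased ones at most 1/2, so some possible
output is neither. -/
theorem exists_output_not_erased {W : DMC X Y} {α : ℝ} {n M : ℕ} (hn : 2 ≤ n)
    (hfar : ∀ x : Fin n → X, ∑ y ∈ Finset.univ.filter (fun y : Fin n → Y =>
      α * n < (hammingDist (fun j => (x j : Y)) y : ℝ)), W.lawN x y ≤ (1 / 2) ^ n)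
    (c : Fin M → Fin n → X) {m : Fin M} (hm : W.erasureProb c m ≤ 1 / 2) :
    ∃ y : Fin n → Y, (hammingDist (fun j => (c m j : Y)) y : ℝ) ≤ α * n ∧
      0 < W.lawN (c m) y ∧ ∀ m', m' ≠ m → W.lawN (c m') y = 0 := by
  by_contra! hcon
  have hcover : ∀ y, W.lawN (c m) y ≤
      (if α * n < (hammingDist (fun j => (c m j : Y)) y : ℝ) then W.lawN (c m) y else 0) +
      (if 1 < W.numPossible c y then W.lawN (c m) y else 0) := by
    intro y
    have h0 := W.lawN_nonneg (c m) y
    by_cases h1 : α * n < (hammingDist (fun j => (c m j : Y)) y : ℝ)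
    · rw [if_pos h1]
      split_ifs <;> linarith
    · rcases h0.eq_or_lt with h2 | h2
      · simp [← h2]
      · obtain ⟨m', hm', h3⟩ := hcon y (not_lt.1 h1) h2
        have h4 : 1 < W.numPossible c y := by
          refine Finset.one_lt_card.2 ⟨m', ?_, m, ?_, hm'⟩
          · simpa using lt_of_le_of_ne (W.lawN_nonneg _ _) (Ne.symm h3)
          · simpa using h2
        simp [h1, h4]
  have hsum := Finset.sum_le_sum fun y (_ : y ∈ Finset.univ) => hcover y
  rw [sum_lawN, Finset.sum_add_distrib, ← Finset.sum_filter, ← Finset.sum_filter] at hsum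
  have h1 := hfar (c m)
  have h2 : ((1 : ℝ) / 2) ^ n ≤ (1 / 2) ^ 2 := pow_le_pow_of_le_one (by norm_num) (by norm_num) hn
  have h3 : W.erasureProb c m = ∑ y ∈ Finset.univ.filter
    (fun y : Fin n → Y => 1 < W.numPossible c y), W.lawN (c m) y := rfl
  norm_num at h2 hm
  rw [← h3] at hsum
  norm_num at h1
  linarith

theorem card_le_of_avgErasureProb_le {W : DMC X Y} (hd : ∀ x : X, 0 < W.law x x) {α η : ℝ}
    {n M : ℕ} (hn : 2 ≤ n)
    (hball : ∀ x : Fin n → Option X,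
      ((Finset.univ.filter fun y : Fin n → Option X => (hammingDist x y : ℝ) ≤ α * n).card : ℝ) ≤
        Real.exp (η * n))
    (hfar : ∀ x : Fin n → X, ∑ y ∈ Finset.univ.filter (fun y : Fin n → Y =>
      α * n < (hammingDist (fun j => (x j : Y)) y : ℝ)), W.lawN x y ≤ (1 / 2) ^ n)
    (c : Fin M → Fin n → X) (hc : W.avgErasureProb c ≤ 1 / 4) :
    (M : ℝ) ≤ 2 * Real.exp (n * (W.spernerCapacity + η)) := by
  set G := Finset.univ.filter fun m => W.erasureProb c m ≤ 2 * (1 / 4) with hG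
  have hhalf : (M : ℝ) / 2 ≤ G.card := W.half_le_card_erasureProb_le c (by norm_num) hc
  have hy : ∀ m : Fin M, ∃ y : Fin n → Y, m ∈ G →
      (hammingDist (fun j => (c m j : Y)) y : ℝ) ≤ α * n ∧
      0 < W.lawN (c m) y ∧ ∀ m', m' ≠ m → W.lawN (c m') y = 0 := by
    intro m
    by_cases hm : m ∈ G
    · obtain ⟨y, hy⟩ := exists_output_not_erased hn hfar c (m := m)
        ((Finset.mem_filter.1 hm).2.trans (by norm_num))
      exact ⟨y, fun _ => hy⟩
    · exact ⟨fun j => c m j, fun h => absurd h hm⟩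
  choose y hy using hy
  -- The pattern records the codeword letters, not the output letters, at the changed positions. Its
  -- distance from the all-`none` word is the number of changes.
  let pat : Fin M → Fin n → Option X := fun m j =>
    if (c m j : Y) = y m j then none else some (c m j)
  set T := Finset.univ.filter fun p : Fin n → Option X =>
    (hammingDist (fun _ => none) p : ℝ) ≤ α * n with hT
  have hmaps : ∀ m ∈ G, pat m ∈ T := by
    intro m hm
    have h := (hy m hm).1
    rw [hT, Finset.mem_filter]
    refine ⟨Finset.mem_univ _, le_trans (le_of_eq ?_) h⟩
    simp only [hammingDist]
    congr 2
    ext j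
    by_cases hj : (c m j : Y) = y m j <;> simp [pat, hj]
  have hfib : ∀ p ∈ T, (G.filter fun m => pat m = p).card ≤
      ⌊Real.exp (n * W.spernerCapacity)⌋₊ := by
    intro p _
    refine Nat.le_floor (card_le_of_pairwise_lawN_eq_zero hd (by omega) c _ ?_)
    intro m hm m' hm' hne
    obtain ⟨hm, hp⟩ := Finset.mem_filter.1 hm
    obtain ⟨hm', hp'⟩ := Finset.mem_filter.1 hm'
    obtain ⟨-, hpos, hzero⟩ := hy m hm
    obtain ⟨j, hj⟩ := (W.lawN_eq_zero_iff _ _).1 (hzero m' hne.symm)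
    refine (W.lawN_eq_zero_iff _ _).2 ⟨j, ?_⟩
    have hpat : pat m j = pat m' j := by rw [hp, hp']
    -- Position `j` makes `y m` impossible for `m'`. It must be unchanged, since at a changed
    -- position both codewords share a letter that can produce `y m j`.
    by_cases h1 : (c m j : Y) = y m j
    · rw [h1]; exact hj
    · exfalso
      have h2 : c m j = c m' j := by
        by_cases h3 : (c m' j : Y) = y m' j
        · simp [pat, h1, h3] at hpat
        · simpa [pat, h1, h3] using hpat
      rw [← h2] at hj
      exact ((W.lawN_pos_iff _ _).1 hpos j).ne' hj
  have hcard := Finset.card_le_mul_card_image_of_maps_to hmaps _ hfib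
  have hGle : (G.card : ℝ) ≤ Real.exp (n * W.spernerCapacity) * Real.exp (η * n) := by
    calc (G.card : ℝ) ≤ (⌊Real.exp (n * W.spernerCapacity)⌋₊ : ℝ) * T.card := by
          exact_mod_cast hcard
      _ ≤ _ := mul_le_mul (Nat.floor_le (Real.exp_nonneg _)) (hball _) (Nat.cast_nonneg _)
          (Real.exp_nonneg _)
  rw [← Real.exp_add] at hGle
  rw [show (n : ℝ) * (W.spernerCapacity + η) = n * W.spernerCapacity + η * n by ring]
  linarith

theorem exists_le_of_zueAchievableAvg (X : Finset Y) {η : ℝ} (hη : 0 < η) :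
    ∃ ε₀ : ℝ, 0 < ε₀ ∧ ε₀ < 1 ∧ ∀ ε : ℝ, ε < ε₀ → ∀ W : DMC X Y, W.IsNoise ε →
      ∀ R, W.ZueAchievableAvg R → R ≤ W.spernerCapacity + η := by
  -- The other half of `η` absorbs the factor 2 from the discarded messages.
  obtain ⟨α, hα, hball⟩ := exists_card_hammingBall_le (Option X) (half_pos hη)
  obtain ⟨ε₀, h0, h1, hfar⟩ := exists_sum_lawN_far_le (X := X) hα
  refine ⟨ε₀, h0, h1, fun ε hε W hW R hR => ?_⟩
  obtain ⟨M, c, hM, hc⟩ := hR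
  have hlog : ∀ᶠ n : ℕ in atTop, Real.log 2 ≤ n * (η / 2) :=
    (tendsto_natCast_atTop_atTop.atTop_mul_const (half_pos hη)).eventually_ge_atTop _
  obtain ⟨n, hMn, hcn, hln, hn⟩ := (hM.and ((hc.eventually_le_const
    (show (0 : ℝ) < 1 / 4 by norm_num)).and (hlog.and (eventually_ge_atTop 2)))).exists
  have hle := card_le_of_avgErasureProb_le (hW.law_self_pos (hε.trans h1)) hn (hball n)
    (hfar ε hε W hW n) (c n) hcn
  have h2 := hMn.trans hle
  rw [← Real.exp_log (show (0 : ℝ) < 2 by norm_num), ← Real.exp_add, Real.exp_le_exp] at h2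
  have hn' : (0 : ℝ) < n := by exact_mod_cast (by omega : 0 < n)
  refine le_of_mul_le_mul_left ?_ hn'
  rw [Real.exp_log (by norm_num)] at h2
  linarith

/-! ### Concatenated codes and the lower bound. -/

/-- The concatenation of the inner codewords `c (w i)`, padded to length `n` by `x₀`. -/
def concatCode {k K N n : ℕ} (hk : 0 < k) (c : Fin K → Fin k → X) (x₀ : X) (w : Fin N → Fin K) :
    Fin n → X := fun j =>
  if h : (j : ℕ) / k < N then c (w ⟨j / k, h⟩) ⟨j % k, Nat.mod_lt _ hk⟩ else x₀

/-- If few letters are changed, then a concatenated word with a distant outer word is impossible. -/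
theorem lawN_concatCode_eq_zero {W : DMC X Y} {k K N n : ℕ} (hk : 0 < k) (hN : N * k ≤ n)
    {c : Fin K → Fin k → X} (hc : W.IsSpernerCode c) (x₀ : X) {w w' : Fin N → Fin K}
    {y : Fin n → Y}
    (h : hammingDist (fun j => (concatCode hk c x₀ w j : Y)) y < hammingDist w w') :
    W.lawN (concatCode hk c x₀ w') y = 0 := by
  -- Pigeonhole: each changed letter spoils at most one block, and there are fewer changes than
  -- blocks where the outer words differ.
  have hblock : ∃ i : Fin N, w i ≠ w' i ∧
      ∀ j : Fin n, (j : ℕ) / k = i → (concatCode hk c x₀ w j : Y) = y j := by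
    by_contra! hcon
    refine absurd h (not_lt.2 ?_)
    simp only [hammingDist]
    have hsub : (Finset.univ.filter fun i => w i ≠ w' i).map Fin.valEmbedding ⊆
        (Finset.univ.filter fun j => (concatCode hk c x₀ w j : Y) ≠ y j).image
          (fun j : Fin n => (j : ℕ) / k) := by
      intro a ha
      obtain ⟨i, hi, rfl⟩ := Finset.mem_map.1 ha
      obtain ⟨j, hj, hne⟩ := hcon i (Finset.mem_filter.1 hi).2
      exact Finset.mem_image.2 ⟨j, Finset.mem_filter.2 ⟨Finset.mem_univ _, hne⟩, hj⟩
    have h1 := Finset.card_le_card hsub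
    rw [Finset.card_map] at h1
    exact h1.trans Finset.card_image_le
  obtain ⟨i, hi, hagree⟩ := hblock
  obtain ⟨l, hl⟩ := (W.lawN_eq_zero_iff _ _).1 (hc (w i) (w' i) hi)
  have hlt : (i : ℕ) * k + l < n := by
    have h1 : ((i : ℕ) + 1) * k ≤ N * k := Nat.mul_le_mul_right k i.2
    have h2 := l.2
    rw [add_mul, one_mul] at h1
    omega
  have hdiv : ((i : ℕ) * k + l) / k = i := by
    rw [mul_comm, Nat.mul_add_div hk, Nat.div_eq_of_lt l.2, add_zero]
  have hmod : ((i : ℕ) * k + l) % k = l := by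
    rw [mul_comm, Nat.mul_add_mod, Nat.mod_eq_of_lt l.2]
  have hval : ∀ v : Fin N → Fin K, concatCode hk c x₀ v (⟨i * k + l, hlt⟩ : Fin n) = c (v i) l := by
    intro v
    simp only [concatCode, hdiv, hmod, i.2, dite_true]
  refine (W.lawN_eq_zero_iff _ _).2 ⟨⟨i * k + l, hlt⟩, ?_⟩
  rw [← hagree ⟨i * k + l, hlt⟩ hdiv, hval, hval]
  exact hl

/-- Concatenating a Sperner code with an outer code of large minimum distance. -/
theorem exists_code_of_isSpernerCode {W : DMC X Y} {k K : ℕ} (hk : 0 < k)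
    {c : Fin K → Fin k → X} (hc : W.IsSpernerCode c) (x₀ : X) {α β V : ℝ} (hβ : 0 ≤ β) {n N : ℕ}
    (hN : N * k ≤ n) (hαβ : α * n ≤ β * N)
    (hball : ∀ x : Fin N → Fin K,
      ((Finset.univ.filter fun y : Fin N → Fin K => (hammingDist x y : ℝ) ≤ β * N).card : ℝ) ≤ V)
    (hfar : ∀ x : Fin n → X, ∑ y ∈ Finset.univ.filter (fun y : Fin n → Y =>
      α * n < (hammingDist (fun j => (x j : Y)) y : ℝ)), W.lawN x y ≤ (1 / 2) ^ n) :
    ∃ (M : ℕ) (d : Fin M → Fin n → X), (K : ℝ) ^ N ≤ M * V ∧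
      W.maxErasureProb d ≤ (1 / 2) ^ n := by
  obtain ⟨C, hC, hcard⟩ := exists_separated_finset (β * N) V (by positivity) hball
  rw [Fintype.card_fin] at hcard
  refine ⟨C.card, fun m => concatCode hk c x₀ (C.equivFin.symm m : Fin N → Fin K), hcard, ?_⟩
  refine Real.iSup_le (fun m => le_trans ?_ (hfar (concatCode hk c x₀ (C.equivFin.symm m).1)))
    (by positivity)
  rw [erasureProb]
  refine Finset.sum_le_sum_of_subset_of_nonneg (fun y hy => ?_) fun y _ _ => W.lawN_nonneg _ _
  refine Finset.mem_filter.2 ⟨Finset.mem_univ _, ?_⟩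
  by_contra hnear
  have hposs := (Finset.mem_filter.1 hy).2
  obtain ⟨m', hm', hmm⟩ := Finset.exists_mem_ne hposs m
  have hpos := (Finset.mem_filter.1 hm').2
  refine hpos.ne' (lawN_concatCode_eq_zero hk hN hc x₀
    (w := (C.equivFin.symm m : Fin N → Fin K)) ?_)
  have h1 := hC _ (C.equivFin.symm m).2 _ (C.equivFin.symm m').2
    fun h => hmm (C.equivFin.symm.injective (Subtype.ext h)).symm
  exact_mod_cast ((not_lt.1 hnear).trans hαβ).trans_lt h1

theorem exists_zueAchievable_of_isSpernerCode {W₀ : DMC X Y} {k K : ℕ} (hk : 0 < k) (hK : 0 < K)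
    {c : Fin K → Fin k → X} (hc : W₀.IsSpernerCode c) (x₀ : X) {R : ℝ}
    (hR : R < Real.log K / k) :
    ∃ ε₀ : ℝ, 0 < ε₀ ∧ ε₀ < 1 ∧ ∀ ε : ℝ, ε < ε₀ → ∀ W : DMC X Y, W.IsNoise ε →
      W.supp = W₀.supp → W.ZueAchievable R := by
  -- One `η` pays for the volume of the outer balls, the other for rounding `n / k` down.
  set η := (Real.log K / k - R) / 2 with hη_def
  have hη : 0 < η := half_pos (sub_pos.2 hR)
  have hk' : (0 : ℝ) < k := by exact_mod_cast hk
  have hk1 : (1 : ℝ) ≤ k := by exact_mod_cast hk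
  have hK' : (0 : ℝ) < K := by exact_mod_cast hK
  obtain ⟨β, hβ, hball⟩ := exists_card_hammingBall_le (Fin K) hη
  -- For `n ≥ k` and `N = n / k`, `n < k * (N + 1) ≤ 2 * k * N`, so this fraction of `n` is at most
  -- `β * N` changes.
  obtain ⟨ε₀, h0, h1, hfar⟩ := exists_sum_lawN_far_le (X := X) (show 0 < β / (2 * k) by positivity)
  refine ⟨ε₀, h0, h1, fun ε hε W hW hsupp => ?_⟩
  have hdiv : ∀ n : ℕ, (n : ℝ) < k * ((n / k : ℕ) + 1) := fun n => by
    exact_mod_cast Nat.lt_mul_div_succ n hk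
  have hcode : ∀ n : ℕ, ∃ d : (M : ℕ) × (Fin M → Fin n → X), k ≤ n →
      (K : ℝ) ^ (n / k) ≤ d.1 * Real.exp (η * (n / k : ℕ)) ∧
      W.maxErasureProb d.2 ≤ (1 / 2) ^ n := by
    intro n
    by_cases hn : k ≤ n
    · have hN1 : (1 : ℝ) ≤ (n / k : ℕ) := by exact_mod_cast Nat.div_pos hn hk
      obtain ⟨M, d, hd⟩ := exists_code_of_isSpernerCode hk
        ((isSpernerCode_iff_of_supp_eq hsupp c).2 hc) x₀ hβ.le (n := n) (N := n / k)
        (Nat.div_mul_le_self n k)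
        (show β / (2 * k) * n ≤ β * (n / k : ℕ) by
          rw [div_mul_eq_mul_div, div_le_iff₀ (by positivity), mul_assoc]
          refine mul_le_mul_of_nonneg_left ?_ hβ.le
          have := hdiv n
          nlinarith) (hball _) (hfar ε hε W hW n)
      exact ⟨⟨M, d⟩, fun _ => hd⟩
    · exact ⟨⟨0, fun m => m.elim0⟩, fun h => absurd h hn⟩
  choose d hd using hcode
  refine ⟨fun n => (d n).1, fun n => (d n).2, ?_, ?_⟩
  · have hlog : ∀ᶠ n : ℕ in atTop, Real.log K ≤ n * η :=
      (tendsto_natCast_atTop_atTop.atTop_mul_const hη).eventually_ge_atTop _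
    filter_upwards [hlog, eventually_ge_atTop k] with n hln hn
    have h2 := (hd n hn).1
    rw [← div_le_iff₀ (Real.exp_pos _)] at h2
    refine le_trans ?_ h2
    rw [← Real.exp_log (pow_pos hK' _), Real.log_pow, ← Real.exp_sub, Real.exp_le_exp]
    have hN : ((n / k : ℕ) : ℝ) ≤ n := by exact_mod_cast Nat.div_le_self n k
    have hlogK : 0 ≤ Real.log K := Real.log_natCast_nonneg K
    have h3 : (n : ℝ) * (Real.log K / k) ≤ ((n / k : ℕ) + 1) * Real.log K := by
      rw [mul_div_assoc', div_le_iff₀ hk']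
      have := mul_le_mul_of_nonneg_right (hdiv n).le hlogK
      linarith
    have h4 : η * (n / k : ℕ) ≤ η * n := mul_le_mul_of_nonneg_left hN hη.le
    have h5 : (n : ℝ) * R = n * (Real.log K / k) - 2 * (η * n) := by
      rw [hη_def]; ring
    linarith
  · refine squeeze_zero' (Eventually.of_forall fun n => W.maxErasureProb_nonneg _) ?_
      (tendsto_pow_atTop_nhds_zero_of_lt_one (show (0 : ℝ) ≤ 1 / 2 by norm_num) (by norm_num))
    filter_upwards [eventually_ge_atTop k] with n hn
    exact (hd n hn).2

end Noise

end DMC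

/-! ### Combination of the two bounds. -/

theorem theorem2 {Y : Type*} [Fintype Y] (X : Finset Y) (hX : X.Nonempty)
    (S : Set (X × Y)) (δ : ℝ) (hδ : 0 < δ) :
    ∃ ε₀ : ℝ, 0 < ε₀ ∧ ε₀ < 1 ∧
      ∀ ε : ℝ, 0 ≤ ε → ε < ε₀ →
        ∀ W : DMC X Y, W.IsNoise ε → W.supp = S →
          |W.zueCapacity - W.spernerCapacity| < δ ∧
          |W.zueCapacityAvg - W.spernerCapacity| < δ := by
  classical
  obtain ⟨ε₁, h₁, h₁', hup⟩ := DMC.exists_le_of_zueAchievableAvg X (half_pos hδ)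
  -- A reference channel fixes the Sperner code, hence the noise threshold, before `W` is given.
  -- Without one the claim is vacuous.
  by_cases hW₀ : ∃ W₀ : DMC X Y, W₀.supp = S ∧ ∀ x : X, 0 < W₀.law x x
  swap
  · exact ⟨ε₁, h₁, h₁', fun ε _ hε W hW hS =>
      absurd ⟨W, hS, hW.law_self_pos (hε.trans h₁')⟩ hW₀⟩
  obtain ⟨W₀, hS₀, hd₀⟩ := hW₀
  obtain ⟨R', ⟨k, K, c, hk, hK, hc, rfl⟩, hR'⟩ :=
    exists_lt_of_lt_csSup (W₀.nonempty_spernerRates hX)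
      (show W₀.spernerCapacity - δ / 2 < W₀.spernerCapacity by linarith)
  obtain ⟨ε₂, h₂, h₂', hlow⟩ := DMC.exists_zueAchievable_of_isSpernerCode hk hK hc
    ⟨hX.choose, hX.choose_spec⟩ hR'
  refine ⟨min ε₁ ε₂, lt_min h₁ h₂, (min_le_left _ _).trans_lt h₁', fun ε _ hε W hW hS => ?_⟩
  have hach := hlow ε (hε.trans_le (min_le_right _ _)) W hW (hS.trans hS₀.symm)
  rw [← DMC.spernerCapacity_eq_of_supp_eq (hS.trans hS₀.symm)] at hach
  have hub := hup ε (hε.trans_le (min_le_left _ _)) W hW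
  have hmax_le : W.zueCapacity ≤ W.spernerCapacity + δ / 2 :=
    csSup_le ⟨_, hach⟩ fun R hR => hub R hR.zueAchievableAvg
  have havg_le : W.zueCapacityAvg ≤ W.spernerCapacity + δ / 2 :=
    csSup_le ⟨_, hach.zueAchievableAvg⟩ hub
  have hmax_ge : W.spernerCapacity - δ / 2 ≤ W.zueCapacity :=
    le_csSup ⟨_, fun R hR => hub R (DMC.ZueAchievable.zueAchievableAvg hR)⟩ hach
  have havg_ge : W.spernerCapacity - δ / 2 ≤ W.zueCapacityAvg :=
    le_csSup ⟨_, hub⟩ hach.zueAchievableAvg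
  rw [abs_lt, abs_lt]
  refine ⟨⟨?_, ?_⟩, ?_, ?_⟩ <;> linarith
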